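/- All rings are commutative with $1\neq 0$. For a ring $R$, the upper ideal relation graph $\Gamma_U(R)$ is the simple graph whose vertices are the non-units of $R$, two distinct vertices $x,y$ being adjacent if and only if there is a non-unit $z\in R$ such that the principal ideals satisfy $(x)\subseteq(z)$ and $(y)\subseteq(z)$. A graph is planar if it can be drawn in the Euclidean plane (vertices as distinct points, edges as simple curves joining their ends) so that no edge passes through a vertex other than its ends and distinct edges meet only at common ends. Theorem. Let $R$ be a finite commutative ring that is not local. Then $\Gamma_U(R)$ is planar if and only if $R$ is isomorphic to one of the following nine rings: $$\mathbb{Z}_2\times\mathbb{Z}_2\times\mathbb{Z}_2,\quad \mathbb{Z}_2\times\mathbb{Z}_4,\quad \mathbb{Z}_2\times\frac{\mathbb{Z}_2[x]}{(x^2)},\quad \mathbb{Z}_2\times\mathbb{F}_4,\quad \mathbb{Z}_2\times\mathbb{Z}_2,\quad \mathbb{Z}_2\times\mathbb{Z}_3,\quad \mathbb{Z}_3\times\mathbb{Z}_3,\quad \mathbb{Z}_3\times\mathbb{F}_4,\quad \mathbb{F}_4\times\mathbb{F}_4,$$ where $\mathbb{Z}_n=\mathbb{Z}/n\mathbb{Z}$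 and $\mathbb{F}_4$ is the field with four elements. -/

import Mathlib

open scoped Polynomial

/-- The upper ideal relation graph of a commutative ring `R`: the vertices are the non-units of `R`,
and two distinct vertices `x`, `y` are adjacent iff there is a non-unit `z` such that the principal
ideals `(x)` and `(y)` are both contained in `(z)`. -/
def upperIdealGraph (R : Type*) [CommRing R] : SimpleGraph {x : R // ¬ IsUnit x} where
  Adj x y := x ≠ y ∧ ∃ z : R, ¬ IsUnit z ∧
    Ideal.span {(x : R)} ≤ Ideal.span {z} ∧ Ideal.span {(y : R)} ≤ Ideal.span {z}
  symm := ⟨fun _ _ h => ⟨h.1.symm, h.2.imp fun _ hz => ⟨hz.1, hz.2.2, hz.2.1⟩⟩⟩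
  loopless := ⟨fun _ h => h.1 rfl⟩

/-- A drawing of the simple graph `G` in the Euclidean plane without edge crossings. (Only the
topology of the plane matters, so the plane is `ℝ × ℝ`.) Vertices are distinct points; every edge
`uv` is a simple curve joining the points of `u` and `v`, the curve attached to `vu` being the one of
`uv` traversed backwards; an edge passes through no vertex other than its two ends; and two different
edges meet at most in common ends. -/
structure PlaneDrawing {V : Type*} (G : SimpleGraph V) where
  /-- the point representing a vertex -/
  point : V → ℝ × ℝ
  point_injective : Function.Injective point
  /-- the curve representing an edge -/
  curve : ∀ {u v : V}, G.Adj u v → Path (point u) (point v)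
  curve_symm : ∀ {u v : V} (h : G.Adj u v), curve h.symm = (curve h).symm
  curve_injective : ∀ {u v : V} (h : G.Adj u v), Function.Injective (curve h)
  eq_end_of_mem : ∀ {u v : V} (h : G.Adj u v) (w : V),
    point w ∈ Set.range (curve h) → w = u ∨ w = v
  no_crossing : ∀ {u v u' v' : V} (h : G.Adj u v) (h' : G.Adj u' v'), s(u, v) ≠ s(u', v') →
    ∀ p ∈ Set.range (curve h) ∩ Set.range (curve h'),
      ∃ w : V, w ∈ s(u, v) ∧ w ∈ s(u', v') ∧ p = point w

/-- A graph is planar if it can be drawn in the plane without edge crossings. -/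
def IsPlanarGraph {V : Type*} (G : SimpleGraph V) : Prop :=
  Nonempty (PlaneDrawing G)

/-! A non-local finite ring splits as `A × B` with both factors nontrivial, by an idempotent power
of some `a` with `a` and `1 - a` non-units. The multiples of a single non-unit form a clique, and a
planar graph contains no K₅. Hence each factor has at most four elements, and if one factor has a
nonzero non-unit then the other has exactly two (`card_le_four_of_isPlanarGraph_prod`,
`card_le_two_of_isPlanarGraph_prod`). Classifying the rings of order at most four leaves the nine
products.

Non-planarity of K₅ is proved without the Jordan curve theorem (`exists_disjoint_edges_meet`). If
disjoint edges never met, the difference of two points running along them would have a continuous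
logarithm on a square, with total increment zero around the boundary. This gives one integer
equation for each of the 15 pairs of disjoint edges, and the system is inconsistent modulo 4.

Conversely, each of the nine graphs embeds in one of three explicit graphs with at most seven
vertices. These have straight-line drawings with integer coordinates, where non-crossing is a finite
check of signs of areas (`isPlanarGraph_of_int`). -/

open Complex

/-! ### Continuous logarithms and their increments along plane curves -/

instance unitInterval.contractibleSpace : ContractibleSpace unitInterval :=
  (convex_Icc (0 : ℝ) 1).contractibleSpace ⟨0, by simp⟩

instance unitInterval.locallyPathConnectedSpace : LocallyPathConnectedSpace unitInterval :=
  (convex_Icc (0 : ℝ) 1).locallyPathConnectedSpace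

/-- A nowhere vanishing continuous function on a simply connected space has a continuous
logarithm. -/
theorem exists_continuousMap_exp_eq {X : Type*} [TopologicalSpace X] [SimplyConnectedSpace X]
    [LocallyPathConnectedSpace X] (g : C(X, ℂ)) (hg : ∀ x, g x ≠ 0) :
    ∃ F : C(X, ℂ), ∀ x, exp (F x) = g x := by
  obtain ⟨x₀⟩ : Nonempty X := inferInstance
  obtain ⟨F, ⟨-, hF⟩, -⟩ := isCoveringMapOn_exp.existsUnique_continuousMap_lifts g
    (exp_log (hg x₀)) (fun x => hg x)
  exact ⟨F, fun x => congrFun hF x⟩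

/-- Two continuous logarithms of the same function on a preconnected space have the same
increments. -/
theorem sub_eq_sub_of_exp_eq_mul {X : Type*} [TopologicalSpace X] [PreconnectedSpace X]
    (F G : C(X, ℂ)) (c : ℂ) (h : ∀ x, exp (F x) = c * exp (G x)) (x y : X) :
    F y - F x = G y - G x := by
  have hc : ∀ z, exp (F z - G z) = c := fun z => by
    rw [exp_sub, h z, mul_div_assoc, div_self (exp_ne_zero _), mul_one]
  have hlift := isCoveringMap_exp.eq_of_comp_eq (A := X) (g₁ := fun z => F z - G z)
    (g₂ := fun _ => F x - G x) (by fun_prop) (by fun_prop)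
    (by ext z; simp [hc]) x rfl
  have := congrFun hlift y
  linear_combination this

/-- The increment of the logarithm of `z - γ t` along a curve `γ` (junk if `γ` meets `z`). -/
noncomputable def logIncrement (z : ℂ) (γ : C(unitInterval, ℂ)) : ℂ :=
  open Classical in
  if h : ∃ F : C(unitInterval, ℂ), ∀ t, exp (F t) = z - γ t then h.choose 1 - h.choose 0 else 0

/-- Continuous logarithms on an interval agree up to a constant, so the one chosen in `logIncrement`
does not matter. The factor `c` absorbs the sign between `γ s - δ t` and `δ t - γ s`. -/
theorem logIncrement_eq {z : ℂ} {γ : C(unitInterval, ℂ)} {c : ℂ} (F : C(unitInterval, ℂ))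
    (hF : ∀ t, exp (F t) = c * (z - γ t)) : F 1 - F 0 = logIncrement z γ := by
  have hz : ∀ t, z - γ t ≠ 0 := fun t h => exp_ne_zero (F t) (by rw [hF, h, mul_zero])
  have h := exists_continuousMap_exp_eq (⟨fun t => z - γ t, by fun_prop⟩ : C(unitInterval, ℂ)) hz
  have h' : ∃ F : C(unitInterval, ℂ), ∀ t, exp (F t) = z - γ t := h
  rw [logIncrement, dif_pos h']
  exact sub_eq_sub_of_exp_eq_mul F h'.choose c (fun t => by rw [hF, h'.choose_spec]) 0 1

theorem exp_logIncrement {z : ℂ} {γ : C(unitInterval, ℂ)} (h : ∀ t, z ≠ γ t) :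
    exp (logIncrement z γ) = (z - γ 1) / (z - γ 0) := by
  obtain ⟨F, hF⟩ := exists_continuousMap_exp_eq (⟨fun t => z - γ t, by fun_prop⟩ : C(unitInterval, ℂ))
    (fun t => sub_ne_zero.2 (h t))
  rw [← logIncrement_eq (c := 1) F (fun t => by rw [hF, one_mul]; rfl), exp_sub, hF, hF]
  rfl

/-- The total increment of the logarithm of `γ s - δ t` around the unit square vanishes. -/
theorem logIncrement_square {γ δ : C(unitInterval, ℂ)} (h : ∀ s t, γ s ≠ δ t) :
    logIncrement (γ 0) δ - logIncrement (γ 1) δ =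
      logIncrement (δ 0) γ - logIncrement (δ 1) γ := by
  obtain ⟨F, hF⟩ := exists_continuousMap_exp_eq
    (⟨fun p => γ p.1 - δ p.2, by fun_prop⟩ : C(unitInterval × unitInterval, ℂ)) (fun p => sub_ne_zero.2 (h p.1 p.2))
  have hF' : ∀ s t, exp (F (s, t)) = γ s - δ t := fun s t => hF (s, t)
  have key1 : ∀ s, F (s, 1) - F (s, 0) = logIncrement (γ s) δ := fun s =>
    logIncrement_eq (c := 1) (⟨fun t => F (s, t), by fun_prop⟩ : C(unitInterval, ℂ))
      (fun t => by simp [hF'])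
  have key2 : ∀ t, F (1, t) - F (0, t) = logIncrement (δ t) γ := fun t =>
    logIncrement_eq (c := -1) (⟨fun s => F (s, t), by fun_prop⟩ : C(unitInterval, ℂ))
      (fun s => by simp [hF'])
  rw [← key1, ← key1, ← key2, ← key2]
  ring

/-! ### Non-planarity of K₅ -/

/-- A logarithm of `f a - f b`, chosen in such a way that interchanging `a` and `b` changes it by
`± π i`. -/
noncomputable def pairLog {n : ℕ} (f : Fin n → ℂ) (a b : Fin n) : ℂ :=
  if a < b then log (f a - f b) else log (f b - f a) + Real.pi * I

theorem exp_pairLog {n : ℕ} {f : Fin n → ℂ} {a b : Fin n} (h : f a ≠ f b) :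
    exp (pairLog f a b) = f a - f b := by
  unfold pairLog
  split_ifs
  · exact exp_log (sub_ne_zero.2 h)
  · rw [exp_add, exp_log (sub_ne_zero.2 h.symm), exp_pi_mul_I]; ring

theorem pairLog_sub_pairLog {n : ℕ} (f : Fin n → ℂ) {a b : Fin n} (h : a ≠ b) :
    pairLog f a b - pairLog f b a = ((if a < b then -1 else 1 : ℤ) : ℂ) * (Real.pi * I) := by
  unfold pairLog
  rcases lt_or_gt_of_ne h with h | h
  · simp [h, h.not_gt]
  · simp [h, h.not_gt]

/-- The complete graph on five vertices cannot be mapped to the plane in such a way that disjoint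
edges have disjoint images. -/
theorem exists_disjoint_edges_meet (f : Fin 5 → ℂ) (γ : Fin 5 → Fin 5 → C(unitInterval, ℂ))
    (h0 : ∀ a b, a < b → γ a b 0 = f a) (h1 : ∀ a b, a < b → γ a b 1 = f b) :
    ∃ a b c d, a < b ∧ c < d ∧ a ≠ c ∧ a ≠ d ∧ b ≠ c ∧ b ≠ d ∧ ∃ s t, γ a b s = γ c d t := by
  by_contra! hne
  have hex : ∀ a c : Fin 5, a ≠ c → ∃ b, b ≠ a ∧ b ≠ c := by decide
  have hex2 : ∀ a c d : Fin 5, a ≠ c → a ≠ d → ∃ b, b ≠ a ∧ b ≠ c ∧ b ≠ d := by decide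
  -- A fourth vertex `b` gives an edge `ab` disjoint from `cd` that has `f a` as an end.
  have hv : ∀ a c d : Fin 5, c < d → a ≠ c → a ≠ d → ∀ t, f a ≠ γ c d t := by
    intro a c d hcd hac had t
    obtain ⟨b, hba, hbc, hbd⟩ := hex2 a c d hac had
    rcases lt_or_gt_of_ne hba with h | h
    · rw [← h1 b a h]; exact hne b a c d h hcd hbc hbd hac had 1 t
    · rw [← h0 a b h]; exact hne a b c d h hcd hac had hbc hbd 0 t
  have hinj : ∀ a c : Fin 5, a ≠ c → f a ≠ f c := by
    intro a c hac
    obtain ⟨d, hda, hdc⟩ := hex a c hac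
    rcases lt_or_gt_of_ne hdc with h | h
    · rw [← h1 d c h]; exact hv a d c h hda.symm hac 1
    · rw [← h0 c d h]; exact hv a c d h hac hda.symm 0
  -- The hypotheses sit inside the existential so that `choose` yields a function on all triples;
  -- its value is 0 on irrelevant ones.
  have hn : ∀ a c d : Fin 5, ∃ n : ℤ, c < d → a ≠ c → a ≠ d →
      logIncrement (f a) (γ c d) = pairLog f a d - pairLog f a c + n * (2 * Real.pi * I) := by
    intro a c d
    by_cases h : c < d ∧ a ≠ c ∧ a ≠ d
    · obtain ⟨hcd, hac, had⟩ := h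
      have := exp_logIncrement (hv a c d hcd hac had)
      rw [h0 c d hcd, h1 c d hcd, ← exp_pairLog (hinj a d had), ← exp_pairLog (hinj a c hac),
        ← exp_sub, exp_eq_exp_iff_exists_int] at this
      exact this.imp fun n hn _ _ _ => hn
    · exact ⟨0, fun a b c => absurd ⟨a, b, c⟩ h⟩
  choose n hn using hn
  have hpi : (Real.pi * I : ℂ) ≠ 0 := by simp [Real.pi_ne_zero]
  have key : ∀ a b c d : Fin 5, a < b → c < d → a ≠ c → a ≠ d → b ≠ c → b ≠ d →
      2 * (n a c d - n b c d - n c a b + n d a b) + (if a < d then -1 else 1)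
        - (if a < c then -1 else 1) - (if b < d then -1 else 1) + (if b < c then -1 else 1)
        = (0 : ℤ) := by
    intro a b c d hab hcd hac had hbc hbd
    have hsq := logIncrement_square (hne a b c d hab hcd hac had hbc hbd)
    rw [h0 a b hab, h1 a b hab, h0 c d hcd, h1 c d hcd, hn a c d hcd hac had,
      hn b c d hcd hbc hbd, hn c a b hab hac.symm hbc.symm, hn d a b hab had.symm hbd.symm] at hsq
    have e1 := pairLog_sub_pairLog f had
    have e2 := pairLog_sub_pairLog f hac
    have e3 := pairLog_sub_pairLog f hbd
    have e4 := pairLog_sub_pairLog f hbc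
    rw [← Int.cast_inj (α := ℂ)]
    apply mul_right_cancel₀ hpi
    rw [Int.cast_add, Int.cast_sub, Int.cast_sub, Int.cast_add, add_mul, sub_mul, sub_mul,
      add_mul, ← e1, ← e2, ← e3, ← e4]
    push_cast
    linear_combination hsq
  -- Each integer `n x c d` that occurs lies in exactly two of these fifteen equations, with
  -- coefficient ±2, so in the sum of all of them the `n`-terms are divisible by 4. The signs
  -- contribute 2 for a pair of interlacing edges and 0 otherwise; there are five interlacing pairs,
  -- so the sum reads 10 ≡ 0 mod 4.
  have k1 := key 0 1 2 3
  have k2 := key 0 1 2 4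
  have k3 := key 0 1 3 4
  have k4 := key 0 2 1 3
  have k5 := key 0 2 1 4
  have k6 := key 0 2 3 4
  have k7 := key 0 3 1 2
  have k8 := key 0 3 1 4
  have k9 := key 0 3 2 4
  have k10 := key 0 4 1 2
  have k11 := key 0 4 1 3
  have k12 := key 0 4 2 3
  have k13 := key 1 2 3 4
  have k14 := key 1 3 2 4
  have k15 := key 1 4 2 3
  clear key hn hpi hinj hv hex hex2 hne h0 h1
  simp +decide only [forall_const, if_true, if_false] at *
  omega

/-- A planar graph has no clique of five vertices. -/
theorem not_isPlanarGraph_of_clique {V : Type*} {G : SimpleGraph V} (v : Fin 5 → V)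
    (hv : ∀ i j, i ≠ j → G.Adj (v i) (v j)) : ¬ IsPlanarGraph G := by
  rintro ⟨D⟩
  have hinj : Function.Injective v := fun i j h => by
    by_contra hij
    exact G.ne_of_adj (hv i j hij) h
  let e : ℝ × ℝ → ℂ := equivRealProdCLM.symm
  have he : Continuous e := equivRealProdCLM.symm.continuous
  have heinj : Function.Injective e := equivRealProdCLM.symm.injective
  -- The constant curve on the diagonal is a junk value.
  let γ : Fin 5 → Fin 5 → C(unitInterval, ℂ) := fun i j =>
    if h : i = j then ContinuousMap.const _ 0
    else ⟨fun t => e (D.curve (hv i j h) t), he.comp (D.curve _).continuous⟩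
  have hγ : ∀ i j (h : i ≠ j) t, γ i j t = e (D.curve (hv i j h) t) := fun i j h t => by
    simp only [γ, dif_neg h]; rfl
  obtain ⟨a, b, c, d, hab, hcd, hac, had, hbc, hbd, s, t, hst⟩ :=
    exists_disjoint_edges_meet (fun i => e (D.point (v i))) γ
      (fun a b h => by rw [hγ a b h.ne]; simp) (fun a b h => by rw [hγ a b h.ne]; simp)
  rw [hγ a b hab.ne, hγ c d hcd.ne] at hst
  have hdis : ∀ w, w ∈ s(v a, v b) → w ∈ s(v c, v d) → False := by
    intro w hw hw'
    rw [Sym2.mem_iff] at hw hw'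
    rcases hw with rfl | rfl <;> rcases hw' with h | h
    exacts [hac (hinj h), had (hinj h), hbc (hinj h), hbd (hinj h)]
  obtain ⟨w, hw, hw', -⟩ := D.no_crossing (hv a b hab.ne) (hv c d hcd.ne)
    (fun h => hdis (v a) (Sym2.mem_mk_left _ _) (h ▸ Sym2.mem_mk_left _ _))
    (D.curve (hv a b hab.ne) s) ⟨⟨s, rfl⟩, ⟨t, (heinj hst).symm⟩⟩
  exact hdis w hw hw'

/-! ### Straight-line drawings -/

/-- Twice the signed area of the triangle `p q r`. -/
def signedArea {K : Type*} [Ring K] (p q r : K × K) : K :=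
  (q.1 - p.1) * (r.2 - p.2) - (q.2 - p.2) * (r.1 - p.1)

theorem signedArea_lineMap (p q r s : ℝ × ℝ) (t : ℝ) :
    signedArea p q (AffineMap.lineMap r s t) =
      (1 - t) * signedArea p q r + t * signedArea p q s := by
  simp only [signedArea, AffineMap.lineMap_apply, vsub_eq_sub, vadd_eq_add, Prod.fst_add,
    Prod.snd_add, Prod.smul_fst, Prod.smul_snd, Prod.fst_sub, Prod.snd_sub, smul_eq_mul]
  ring

theorem signedArea_lineMap_self (p q : ℝ × ℝ) (t : ℝ) :
    signedArea p q (AffineMap.lineMap p q t) = 0 := by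
  rw [signedArea_lineMap]; simp only [signedArea]; ring

/-- If `r` and `s` lie strictly on the same side of the line `pq`, convexity keeps the segment `rs`
off that line. -/
theorem signedArea_lineMap_ne_zero {p q r s : ℝ × ℝ}
    (h : 0 < signedArea p q r * signedArea p q s) {t : ℝ} (ht : t ∈ Set.Icc (0 : ℝ) 1) :
    signedArea p q (AffineMap.lineMap r s t) ≠ 0 := by
  rw [signedArea_lineMap]
  intro h0
  have ht' : 0 ≤ 1 - t := sub_nonneg.2 ht.2
  have hr : signedArea p q r ≠ 0 := left_ne_zero_of_mul h.ne'
  have hs : signedArea p q s ≠ 0 := right_ne_zero_of_mul h.ne'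
  have h1 : 0 < signedArea p q r ^ 2 := by positivity
  rcases ht.1.eq_or_lt with rfl | htpos
  · simp [hr] at h0
  · have := mul_pos htpos h
    have := mul_nonneg ht' h1.le
    have : signedArea p q r * ((1 - t) * signedArea p q r + t * signedArea p q s) = 0 := by
      rw [h0, mul_zero]
    nlinarith

/-- Segments with a common end in general position meet only there. -/
theorem eq_of_lineMap_eq_lineMap {p q r : ℝ × ℝ} (h : signedArea p q r ≠ 0) {s t : ℝ}
    (hst : (AffineMap.lineMap p q s : ℝ × ℝ) = AffineMap.lineMap p r t) :
    (AffineMap.lineMap p q s : ℝ × ℝ) = p := by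
  have h0 := signedArea_lineMap_self p q s
  rw [hst, signedArea_lineMap] at h0
  have hp : signedArea p q p = 0 := by simp [signedArea]
  rw [hp, mul_zero, zero_add] at h0
  rw [hst, (mul_eq_zero.1 h0).resolve_right h, AffineMap.lineMap_apply_zero]

/-- A straight-line drawing, with vertices in general position. -/
theorem isPlanarGraph_of_straight {V : Type*} {G : SimpleGraph V} (P : V → ℝ × ℝ)
    (hP : Function.Injective P)
    (h3 : ∀ u v w, G.Adj u v → w ≠ u → w ≠ v → signedArea (P u) (P v) (P w) ≠ 0)
    (h4 : ∀ u v u' v', G.Adj u v → G.Adj u' v' → u' ≠ u → u' ≠ v → v' ≠ u → v' ≠ v →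
      0 < signedArea (P u) (P v) (P u') * signedArea (P u) (P v) (P v') ∨
      0 < signedArea (P u') (P v') (P u) * signedArea (P u') (P v') (P v)) :
    IsPlanarGraph G := by
  have hmeet : ∀ u v w, G.Adj u v → G.Adj u w → v ≠ w →
      ∀ p ∈ Set.range (Path.segment (P u) (P v)) ∩ Set.range (Path.segment (P u) (P w)),
        p = P u := by
    rintro u v w huv huw hvw _ ⟨⟨s, rfl⟩, ⟨t, ht⟩⟩
    rw [Path.segment_apply, Path.segment_apply] at ht
    rw [Path.segment_apply]
    exact eq_of_lineMap_eq_lineMap (h3 u v w huv huw.ne' hvw.symm) ht.symm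
  have hsymm : ∀ u v, Set.range (Path.segment (P u) (P v)) =
      Set.range (Path.segment (P v) (P u)) := fun u v => by
    rw [Path.range_segment, Path.range_segment, segment_symm]
  refine ⟨⟨P, hP, fun {u v} _ => Path.segment (P u) (P v), fun _ => by simp, ?_, ?_, ?_⟩⟩
  · intro u v h s t hst
    have := AffineMap.lineMap_injective ℝ (hP.ne h.ne) (by simpa using hst)
    exact Subtype.ext this
  · rintro u v h w ⟨t, ht⟩
    by_contra! hw
    apply h3 u v w h hw.1 hw.2
    rw [← ht, Path.segment_apply, signedArea_lineMap_self]
  · intro u v u' v' h h' hne p hp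
    by_cases h1 : u = u'
    · subst h1
      exact ⟨u, by simp, by simp, hmeet u v v' h h' (by rintro rfl; exact hne rfl) p hp⟩
    by_cases h2 : u = v'
    · subst h2
      rw [hsymm u' u] at hp
      exact ⟨u, by simp, by simp, hmeet u v u' h h'.symm
        (by rintro rfl; exact hne Sym2.eq_swap) p hp⟩
    by_cases h5 : v = u'
    · subst h5
      rw [hsymm u v] at hp
      exact ⟨v, by simp, by simp, hmeet v u v' h.symm h' h2 p hp⟩
    by_cases h6 : v = v'
    · subst h6
      rw [hsymm u v, hsymm u' v] at hp
      exact ⟨v, by simp, by simp, hmeet v u u' h.symm h'.symm h1 p hp⟩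
    exfalso
    obtain ⟨⟨s, rfl⟩, ⟨t, ht⟩⟩ := hp
    rw [Path.segment_apply, Path.segment_apply] at ht
    -- One of the two edges lies strictly on one side of the line through the other.
    rcases h4 u v u' v' h h' (Ne.symm h1) (Ne.symm h5) (Ne.symm h2) (Ne.symm h6) with h4 | h4
    · exact signedArea_lineMap_ne_zero h4 t.2 (by rw [ht, signedArea_lineMap_self])
    · exact signedArea_lineMap_ne_zero h4 s.2 (by rw [← ht, signedArea_lineMap_self])

/-- A straight-line drawing with integral vertices in general position. -/
theorem isPlanarGraph_of_int {V : Type*} {G : SimpleGraph V} (P : V → ℤ × ℤ)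
    (hP : ∀ u v, u ≠ v → P u ≠ P v)
    (h3 : ∀ u v w, G.Adj u v → w ≠ u → w ≠ v → signedArea (P u) (P v) (P w) ≠ 0)
    (h4 : ∀ u v, G.Adj u v → ∀ u' v', G.Adj u' v' → u' ≠ u → u' ≠ v → v' ≠ u → v' ≠ v →
      0 < signedArea (P u) (P v) (P u') * signedArea (P u) (P v) (P v') ∨
      0 < signedArea (P u') (P v') (P u) * signedArea (P u') (P v') (P v)) :
    IsPlanarGraph G := by
  let c : ℤ × ℤ → ℝ × ℝ := fun p => (p.1, p.2)
  have hc : ∀ p q r, signedArea (c p) (c q) (c r) = (signedArea p q r : ℤ) := fun p q r => by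
    simp only [signedArea, c]; push_cast; ring
  refine isPlanarGraph_of_straight (fun v => c (P v)) (fun u v huv => ?_) ?_ ?_
  · by_contra h
    refine hP u v h (Prod.ext ?_ ?_)
    · simpa [c] using congrArg Prod.fst huv
    · simpa [c] using congrArg Prod.snd huv
  · intro u v w h hu hv
    rw [hc]
    exact_mod_cast h3 u v w h hu hv
  · intro u v u' v' h h' a1 a2 a3 a4
    rw [hc, hc, hc, hc]
    exact_mod_cast h4 u v h u' v' h' a1 a2 a3 a4

/-- Planarity passes to (not necessarily induced) subgraphs. -/
theorem IsPlanarGraph.of_injective {V W : Type*} {G : SimpleGraph V} {H : SimpleGraph W}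
    (hH : IsPlanarGraph H) (f : V → W) (hf : Function.Injective f)
    (hadj : ∀ u v, G.Adj u v → H.Adj (f u) (f v)) : IsPlanarGraph G := by
  obtain ⟨D⟩ := hH
  refine ⟨⟨fun v => D.point (f v), D.point_injective.comp hf,
    fun h => D.curve (hadj _ _ h), fun h => D.curve_symm _, fun h => D.curve_injective _, ?_, ?_⟩⟩
  · intro u v h w hw
    exact (D.eq_end_of_mem _ _ hw).imp (fun h => hf h) (fun h => hf h)
  · intro u v u' v' h h' hne p hp
    have hne' : s(f u, f v) ≠ s(f u', f v') := fun he =>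
      hne (Sym2.map.injective hf (by simpa using he))
    obtain ⟨w, hw, hw', rfl⟩ := D.no_crossing (hadj _ _ h) (hadj _ _ h') hne' p hp
    rw [Sym2.mem_iff] at hw
    rcases hw with rfl | rfl
    · exact ⟨u, by simp, by simpa [hf.eq_iff] using hw', rfl⟩
    · exact ⟨v, by simp, by simpa [hf.eq_iff] using hw', rfl⟩

/-! ### Three planar model graphs -/

/-- Two complete graphs on four vertices glued at a vertex. -/
def twoK4GluedAtVertex : SimpleGraph {p : Fin 4 × Fin 4 // p.1 = 0 ∨ p.2 = 0} where
  Adj p q := p ≠ q ∧ ((p.1.1 = 0 ∧ q.1.1 = 0) ∨ (p.1.2 = 0 ∧ q.1.2 = 0))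
  symm := ⟨fun _ _ h => ⟨h.1.symm, h.2.imp And.symm And.symm⟩⟩
  loopless := ⟨fun _ h => h.1 rfl⟩

instance : DecidableRel twoK4GluedAtVertex.Adj := fun _ _ => instDecidableAnd

set_option synthInstance.maxSize 1024 in
theorem isPlanarGraph_twoK4GluedAtVertex : IsPlanarGraph twoK4GluedAtVertex := by
  refine isPlanarGraph_of_int
    (fun p => if p.1.1 = 0 then ![(4, 2), (1, 1), (3, 1), (3, 0)] p.1.2
      else ![(4, 2), (0, 3), (2, 4), (1, 3)] p.1.1) ?_ ?_ ?_ <;> decide +kernel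

/-- Two complete graphs on four vertices glued along an edge. -/
def twoK4GluedAlongEdge : SimpleGraph {p : ZMod 2 × Fin 4 // p.1 = 0 ∨ p.2 ≤ 1} where
  Adj p q := p ≠ q ∧ ((p.1.1 = 0 ∧ q.1.1 = 0) ∨ (p.1.2 ≤ 1 ∧ q.1.2 ≤ 1))
  symm := ⟨fun _ _ h => ⟨h.1.symm, h.2.imp And.symm And.symm⟩⟩
  loopless := ⟨fun _ h => h.1 rfl⟩

instance : DecidableRel twoK4GluedAlongEdge.Adj := fun _ _ => instDecidableAnd

set_option synthInstance.maxSize 1024 in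
theorem isPlanarGraph_twoK4GluedAlongEdge : IsPlanarGraph twoK4GluedAlongEdge := by
  refine isPlanarGraph_of_int
    (fun p => if p.1.1 = 0 then ![(1, 0), (3, 3), (2, 1), (2, 0)] p.1.2
      -- The last two entries are never used: here `p.1.2 ≤ 1`.
      else ![(0, 3), (1, 1), (0, 0), (0, 0)] p.1.2) ?_ ?_ ?_ <;> decide +kernel

/-- The graph on the triples of bits with a zero coordinate in which two triples are adjacent when
they have a common zero coordinate. -/
def commonZeroGraph :
    SimpleGraph {p : ZMod 2 × ZMod 2 × ZMod 2 // p.1 = 0 ∨ p.2.1 = 0 ∨ p.2.2 = 0} where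
  Adj p q := p ≠ q ∧ ((p.1.1 = 0 ∧ q.1.1 = 0) ∨ (p.1.2.1 = 0 ∧ q.1.2.1 = 0) ∨
    (p.1.2.2 = 0 ∧ q.1.2.2 = 0))
  symm := ⟨fun _ _ h => ⟨h.1.symm, h.2.imp And.symm (Or.imp And.symm And.symm)⟩⟩
  loopless := ⟨fun _ h => h.1 rfl⟩

instance : DecidableRel commonZeroGraph.Adj := fun _ _ => instDecidableAnd

set_option synthInstance.maxSize 1024 in
theorem isPlanarGraph_commonZeroGraph : IsPlanarGraph commonZeroGraph := by
  refine isPlanarGraph_of_int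
    (fun p => if p.1.1 = 0 then
        if p.1.2.1 = 0 then if p.1.2.2 = 0 then (5, 6) else (6, 12)
        else if p.1.2.2 = 0 then (12, 1) else (8, 5)
      else
        if p.1.2.1 = 0 then if p.1.2.2 = 0 then (-1, 0) else (3, 6) else (7, 1))
    ?_ ?_ ?_ <;> decide +kernel

/-! ### Upper ideal relation graphs of products -/

section UpperIdealGraph

variable {A B C : Type*} [CommRing A] [CommRing B] [CommRing C]

theorem upperIdealGraph_adj_iff {x y : {x : A // ¬ IsUnit x}} :
    (upperIdealGraph A).Adj x y ↔
      x ≠ y ∧ ∃ z : A, ¬ IsUnit z ∧ z ∣ (x : A) ∧ z ∣ (y : A) := by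
  simp only [upperIdealGraph, Ideal.span_singleton_le_span_singleton]

theorem IsPlanarGraph.upperIdealGraph_of_ringEquiv (e : A ≃+* B)
    (h : IsPlanarGraph (upperIdealGraph B)) : IsPlanarGraph (upperIdealGraph A) := by
  refine h.of_injective (fun x => ⟨e x, fun hx => x.2 ((MulEquiv.isUnit_map e).1 hx)⟩)
    (fun x y hxy => Subtype.ext (e.injective (congrArg Subtype.val hxy))) (fun x y hxy => ?_)
  rw [upperIdealGraph_adj_iff] at hxy ⊢
  obtain ⟨hne, z, hz, hzx, hzy⟩ := hxy
  exact ⟨fun hxy => hne (Subtype.ext (e.injective (congrArg Subtype.val hxy))), e z,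
    fun hx => hz ((MulEquiv.isUnit_map e).1 hx), map_dvd e hzx, map_dvd e hzy⟩

/-- A non-unit `z` has a non-unit coordinate, and all multiples of `z` are non-units there. This
direction suffices for planarity, which passes to subgraphs. -/
theorem upperIdealGraph_prod_adj {x y : {x : A × B // ¬ IsUnit x}}
    (h : (upperIdealGraph (A × B)).Adj x y) :
    (¬ IsUnit x.1.1 ∧ ¬ IsUnit y.1.1) ∨ (¬ IsUnit x.1.2 ∧ ¬ IsUnit y.1.2) := by
  rw [upperIdealGraph_adj_iff] at h
  obtain ⟨-, z, hz, ⟨a, ha⟩, ⟨b, hb⟩⟩ := h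
  rw [Prod.isUnit_iff, not_and_or] at hz
  rw [ha, hb]
  simp only [Prod.fst_mul, Prod.snd_mul, IsUnit.mul_iff]
  tauto

theorem upperIdealGraph_prod_prod_adj {x y : {x : A × B × C // ¬ IsUnit x}}
    (h : (upperIdealGraph (A × B × C)).Adj x y) :
    (¬ IsUnit x.1.1 ∧ ¬ IsUnit y.1.1) ∨ (¬ IsUnit x.1.2.1 ∧ ¬ IsUnit y.1.2.1) ∨
      (¬ IsUnit x.1.2.2 ∧ ¬ IsUnit y.1.2.2) := by
  rw [upperIdealGraph_adj_iff] at h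
  obtain ⟨-, z, hz, ⟨a, ha⟩, ⟨b, hb⟩⟩ := h
  rw [Prod.isUnit_iff, Prod.isUnit_iff, not_and_or, not_and_or] at hz
  rw [ha, hb]
  simp only [Prod.fst_mul, Prod.snd_mul, IsUnit.mul_iff]
  tauto

/-- A clique of five multiples of a non-unit obstructs planarity. -/
theorem not_isPlanarGraph_upperIdealGraph {z : A} (hz : ¬ IsUnit z) {X : Type*} [Finite X]
    (hX : 5 ≤ Nat.card X) (f : X → A) (hf : Function.Injective f) (hdvd : ∀ x, z ∣ f x) :
    ¬ IsPlanarGraph (upperIdealGraph A) := by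
  let e := Finite.equivFin X
  let v : Fin 5 → X := fun i => e.symm (Fin.castLE hX i)
  have hv : Function.Injective v := e.symm.injective.comp (Fin.castLE_injective hX)
  refine not_isPlanarGraph_of_clique
    (fun i => ⟨f (v i), fun h => hz (isUnit_of_dvd_unit (hdvd _) h)⟩) (fun i j hij => ?_)
  rw [upperIdealGraph_adj_iff]
  exact ⟨fun h => hij (hv (hf (congrArg Subtype.val h))), z, hz, hdvd _, hdvd _⟩

theorem card_le_four_of_isPlanarGraph_prod [Nontrivial A] [Finite B]
    (h : IsPlanarGraph (upperIdealGraph (A × B))) : Nat.card B ≤ 4 := by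
  by_contra! hB
  refine not_isPlanarGraph_upperIdealGraph (A := A × B) (z := (0, 1)) (by simp [Prod.isUnit_iff])
    hB (fun b => (0, b)) (fun b b' hb => by simpa using hb) (fun b => ⟨(0, b), by simp⟩) h

/-- If `A × B` has planar graph and `A` has a nonzero non-unit, then `B` has at most two elements. -/
theorem card_le_two_of_isPlanarGraph_prod [Finite B] {m : A} (hm0 : m ≠ 0) (hm : ¬ IsUnit m)
    (h : IsPlanarGraph (upperIdealGraph (A × B))) : Nat.card B ≤ 2 := by
  by_contra! hB
  -- The pairs `(0, b)` and `(m, b)` are multiples of `(m, 1)`; there are at least six of them.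
  refine not_isPlanarGraph_upperIdealGraph (A := A × B) (z := (m, 1))
    (by simp [Prod.isUnit_iff, hm]) (X := Fin 2 × B) (by simp; omega)
    (fun p => (if p.1 = 0 then 0 else m, p.2)) ?_ ?_ h
  · rintro ⟨i, b⟩ ⟨j, b'⟩ h
    fin_cases i <;> fin_cases j <;> simp_all [eq_comm]
  · rintro ⟨i, b⟩
    rw [Prod.mk_dvd_mk]
    exact ⟨by split_ifs <;> simp, one_dvd _⟩

theorem exists_injective_fin_four_of_card_le [Finite A] (h : Nat.card A ≤ 4) :
    ∃ f : A → Fin 4, Function.Injective f ∧ f 0 = 0 := by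
  let e := (Finite.equivFin A).toEmbedding.trans (Fin.castLEEmb h)
  exact ⟨fun a => Equiv.swap (e 0) 0 (e a),
    (Equiv.injective _).comp e.injective, Equiv.swap_apply_left _ _⟩

/-- In a field only 0 is a non-unit, so adjacent vertices share a zero coordinate: the two
coordinate axes are cliques of size at most four meeting at the origin. -/
theorem isPlanarGraph_upperIdealGraph_prod_field {K L : Type*} [Field K] [Field L] [Finite K]
    [Finite L] (hK : Nat.card K ≤ 4) (hL : Nat.card L ≤ 4) :
    IsPlanarGraph (upperIdealGraph (K × L)) := by
  obtain ⟨f, hf, hf0⟩ := exists_injective_fin_four_of_card_le hK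
  obtain ⟨g, hg, hg0⟩ := exists_injective_fin_four_of_card_le hL
  have hf' : ∀ a, ¬ IsUnit a → f a = 0 := fun a ha => by
    rw [isUnit_iff_ne_zero, not_not] at ha; rw [ha, hf0]
  have hg' : ∀ a, ¬ IsUnit a → g a = 0 := fun a ha => by
    rw [isUnit_iff_ne_zero, not_not] at ha; rw [ha, hg0]
  have hinj : Function.Injective (Prod.map f g) := hf.prodMap hg
  refine isPlanarGraph_twoK4GluedAtVertex.of_injective (fun x => ⟨Prod.map f g x.1, ?_⟩)
    (fun x y hxy => Subtype.ext (hinj (congrArg Subtype.val hxy))) (fun x y hxy => ?_)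
  · have := x.2
    rw [Prod.isUnit_iff, not_and_or] at this
    exact this.imp (hf' _) (hg' _)
  · refine ⟨fun h => hxy.ne (Subtype.ext (hinj (congrArg Subtype.val h))), ?_⟩
    exact (upperIdealGraph_prod_adj hxy).imp (And.imp (hf' _) (hf' _)) (And.imp (hg' _) (hg' _))

theorem isPlanarGraph_upperIdealGraph_zmod_two_prod [Finite A] (hA : Nat.card A = 4) {m : A}
    (hm0 : m ≠ 0) (hm : ∀ x : A, ¬ IsUnit x → x = 0 ∨ x = m) :
    IsPlanarGraph (upperIdealGraph (ZMod 2 × A)) := by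
  obtain ⟨g', hg', hg0'⟩ := exists_injective_fin_four_of_card_le hA.le
  have hne : g' m ≠ 0 := fun h => hm0 (hg' (h.trans hg0'.symm))
  -- The swap moves the non-units 0 and `m` to 0 and 1, the ends of the shared edge.
  let g : A → Fin 4 := fun a => Equiv.swap (g' m) 1 (g' a)
  have hg : Function.Injective g := (Equiv.injective _).comp hg'
  have hg1 : ∀ a, ¬ IsUnit a → g a ≤ 1 := fun a ha => by
    rcases hm a ha with rfl | rfl
    · simp only [g]
      rw [hg0', Equiv.swap_apply_of_ne_of_ne hne.symm (by decide)]
      decide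
    · simp [g]
  have h2 : ∀ a : ZMod 2, ¬ IsUnit a → a = 0 := by decide
  have hinj : Function.Injective (Prod.map (id : ZMod 2 → ZMod 2) g) :=
    Function.injective_id.prodMap hg
  refine isPlanarGraph_twoK4GluedAlongEdge.of_injective (fun x => ⟨Prod.map id g x.1, ?_⟩)
    (fun x y hxy => Subtype.ext (hinj (congrArg Subtype.val hxy))) (fun x y hxy => ?_)
  · have := x.2
    rw [Prod.isUnit_iff, not_and_or] at this
    exact this.imp (h2 _) (hg1 _)
  · refine ⟨fun h => hxy.ne (Subtype.ext (hinj (congrArg Subtype.val h))), ?_⟩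
    exact (upperIdealGraph_prod_adj hxy).imp (And.imp (h2 _) (h2 _)) (And.imp (hg1 _) (hg1 _))

theorem isPlanarGraph_upperIdealGraph_zmod_two_cubed :
    IsPlanarGraph (upperIdealGraph (ZMod 2 × ZMod 2 × ZMod 2)) := by
  have h2 : ∀ a : ZMod 2, ¬ IsUnit a → a = 0 := by decide
  refine isPlanarGraph_commonZeroGraph.of_injective (fun x => ⟨x.1, ?_⟩)
    (fun x y hxy => Subtype.ext (Subtype.mk.inj hxy)) (fun x y hxy => ?_)
  · have := x.2
    rw [Prod.isUnit_iff, Prod.isUnit_iff, not_and_or, not_and_or] at this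
    exact this.imp (h2 _) (Or.imp (h2 _) (h2 _))
  · refine ⟨fun h => hxy.ne (Subtype.ext (Subtype.mk.inj h)), ?_⟩
    exact (upperIdealGraph_prod_prod_adj hxy).imp (And.imp (h2 _) (h2 _))
      (Or.imp (And.imp (h2 _) (h2 _)) (And.imp (h2 _) (h2 _)))

end UpperIdealGraph

/-! ### Splitting by idempotents and the rings of order at most four -/

section Classification

/-- A suitable power of an element of a finite monoid is idempotent. -/
theorem exists_isIdempotentElem_pow {M : Type*} [Monoid M] [Finite M] (a : M) :
    ∃ n, 0 < n ∧ IsIdempotentElem (a ^ n) := by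
  obtain ⟨i, k, hk, hik⟩ : ∃ i k, 0 < k ∧ a ^ (i + k) = a ^ i := by
    obtain ⟨i, j, hij, hne⟩ := Finite.exists_ne_map_eq_of_infinite (fun n : ℕ => a ^ n)
    rcases lt_or_gt_of_ne hij with h | h
    · exact ⟨i, j - i, by omega, by rw [Nat.add_sub_cancel' h.le]; exact hne.symm⟩
    · exact ⟨j, i - j, by omega, by rw [Nat.add_sub_cancel' h.le]; exact hne⟩
  have hstep : ∀ n l, i ≤ n → a ^ (n + k * l) = a ^ n := by
    intro n l hn
    induction l with
    | zero => simp
    | succ l ih =>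
      obtain ⟨r, rfl⟩ := Nat.exists_eq_add_of_le hn
      rw [← ih, show i + r + k * (l + 1) = (i + k) + (r + k * l) by ring, pow_add a (i + k), hik,
        ← pow_add, add_assoc]
  -- The exponent is a positive multiple of the period `k` and at least the preperiod `i`, so
  -- doubling it does not change the power.
  refine ⟨k * (i + 1), by positivity, ?_⟩
  rw [IsIdempotentElem, ← pow_add]
  exact hstep _ _ (by nlinarith)

variable {A : Type*} [CommRing A]

/-- The decomposition of a ring given by an idempotent. -/
noncomputable def ringEquivProdOfIsIdempotentElem {e : A} (he : IsIdempotentElem e) :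
    A ≃+* (A ⧸ Ideal.span {e}) × (A ⧸ Ideal.span {1 - e}) :=
  have hco : IsCoprime (Ideal.span {e}) (Ideal.span {1 - e}) := by
    rw [Ideal.isCoprime_span_singleton_iff]
    exact ⟨1, 1, by ring⟩
  have hbot : Ideal.span {e} * Ideal.span {1 - e} = ⊥ := by
    rw [Ideal.span_singleton_mul_span_singleton, Ideal.span_singleton_eq_bot, mul_sub, mul_one,
      he.eq, sub_self]
  ((RingEquiv.quotientBot A).symm.trans (Ideal.quotEquivOfEq hbot.symm)).trans
    (Ideal.quotientMulEquivQuotientProd _ _ hco)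

theorem nontrivial_quotient_span_singleton {e : A} (he : ¬ IsUnit e) :
    Nontrivial (A ⧸ Ideal.span {e}) :=
  Ideal.Quotient.nontrivial_iff.2 (mt Ideal.span_singleton_eq_top.1 he)

/-- A finite ring which is not local is a product of two nontrivial rings. -/
theorem exists_ringEquiv_prod_of_not_isLocalRing [Finite A] [Nontrivial A]
    (hA : ¬ IsLocalRing A) :
    ∃ I J : Ideal A, Nontrivial (A ⧸ I) ∧ Nontrivial (A ⧸ J) ∧
      Nonempty (A ≃+* (A ⧸ I) × (A ⧸ J)) := by
  obtain ⟨a, ha, ha'⟩ : ∃ a : A, ¬ IsUnit a ∧ ¬ IsUnit (1 - a) := by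
    by_contra! h
    exact hA (IsLocalRing.of_isUnit_or_isUnit_one_sub_self fun a => or_iff_not_imp_left.2 (h a))
  obtain ⟨n, hn, he⟩ := exists_isIdempotentElem_pow a
  refine ⟨_, _, nontrivial_quotient_span_singleton (mt (isUnit_pow_iff hn.ne').1 ha),
    nontrivial_quotient_span_singleton fun hu => ha' ?_, ⟨ringEquivProdOfIsIdempotentElem he⟩⟩
  -- If `1 - a ^ n` were a unit, it would cancel from `a ^ n * (1 - a ^ n) = 0`, making `a`
  -- nilpotent and `1 - a` a unit.
  have h0 : a ^ n = 0 := by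
    rw [← hu.mul_left_eq_zero, mul_sub, mul_one, he.eq, sub_self]
  exact IsNilpotent.isUnit_one_sub ⟨n, h0⟩

theorem nonempty_ringEquiv_zmod_of_prime [Finite A] {p : ℕ} (hp : p.Prime) (h : Nat.card A = p) :
    Nonempty (A ≃+* ZMod p) := by
  have := Fintype.ofFinite A
  exact ⟨(ZMod.ringEquivOfPrime A hp (by rw [← Nat.card_eq_fintype_card, h])).symm⟩

theorem nonempty_ringEquiv_galoisField_two_two [Finite A] (hA : IsField A)
    (h : Nat.card A = 4) : Nonempty (A ≃+* GaloisField 2 2) := by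
  let := hA.toField
  have := Fintype.ofFinite A
  have := Fintype.ofFinite (GaloisField 2 2)
  refine ⟨FiniteField.ringEquivOfCardEq ?_⟩
  rw [← Nat.card_eq_fintype_card, ← Nat.card_eq_fintype_card, h, GaloisField.card 2 2 two_ne_zero]
  rfl

/-- A ring of order four and characteristic two consists of `0, 1, m, 1 + m` for any non-unit
`m ≠ 0`. -/
theorem eq_of_card_eq_four (h4 : Nat.card A = 4) (h2 : (2 : A) = 0) {m : A}
    (hm0 : m ≠ 0) (hm : ¬ IsUnit m) (x : A) : x = 0 ∨ x = 1 ∨ x = m ∨ x = 1 + m := by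
  have : Finite A := Nat.finite_of_card_ne_zero (by rw [h4]; decide)
  have : Nontrivial A := ⟨m, 0, hm0⟩
  have hm1 : m ≠ 1 := fun h => hm (h ▸ isUnit_one)
  have hm1' : 1 + m ≠ 0 := fun h => hm1 (by linear_combination h - h2)
  have hinj : Function.Injective ![(0 : A), 1, m, 1 + m] := by
    clear h2 hm
    intro i j hij
    fin_cases i <;> fin_cases j <;> simp_all [eq_comm]
  have hsurj := (hinj.bijective_of_nat_card_le (by simp [h4])).2 x
  obtain ⟨i, rfl⟩ := hsurj
  fin_cases i <;> simp

theorem card_zmod_two_polynomial_quotient :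
    Nat.card ((ZMod 2)[X] ⧸ Ideal.span {(Polynomial.X : (ZMod 2)[X]) ^ 2}) = 4 := by
  have hm : ((Polynomial.X : (ZMod 2)[X]) ^ 2).Monic := Polynomial.monic_X_pow 2
  let b := AdjoinRoot.powerBasis' hm
  have : Module.Finite (ZMod 2) (AdjoinRoot ((Polynomial.X : (ZMod 2)[X]) ^ 2)) := b.finite
  change Nat.card (AdjoinRoot ((Polynomial.X : (ZMod 2)[X]) ^ 2)) = 4
  rw [Module.natCard_eq_pow_finrank (K := ZMod 2), b.finrank, AdjoinRoot.powerBasis'_dim,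
    Polynomial.natDegree_X_pow, Nat.card_zmod]
  rfl

/-- Sending `X` to `m` kills `X ^ 2` and hits all of `0, 1, m, 1 + m`; equal cardinalities make the
surjection bijective. -/
theorem nonempty_ringEquiv_of_sq_eq_zero (h4 : Nat.card A = 4) (h2 : (2 : A) = 0) {m : A}
    (hm0 : m ≠ 0) (hm : m * m = 0) :
    Nonempty (A ≃+* (ZMod 2)[X] ⧸ Ideal.span {(Polynomial.X : (ZMod 2)[X]) ^ 2}) := by
  have : Finite A := Nat.finite_of_card_ne_zero (by rw [h4]; decide)
  have : Nontrivial A := ⟨m, 0, hm0⟩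
  have : CharP A 2 := (CharP.charP_iff_prime_eq_zero Nat.prime_two).2 (by exact_mod_cast h2)
  have hu : ¬ IsUnit m := fun h => hm0 (h.mul_left_eq_zero.1 hm)
  let f : (ZMod 2)[X] →+* A := Polynomial.eval₂RingHom (ZMod.castHom dvd_rfl A) m
  have hX : f Polynomial.X = m := by simp [f]
  let g : (ZMod 2)[X] ⧸ Ideal.span {(Polynomial.X : (ZMod 2)[X]) ^ 2} →+* A :=
    Ideal.Quotient.lift _ f (fun a ha => by
      obtain ⟨b, rfl⟩ := Ideal.mem_span_singleton.1 ha
      rw [map_mul, map_pow, hX, pow_two, hm, zero_mul])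
  have hg : Function.Surjective g := by
    intro x
    rcases eq_of_card_eq_four h4 h2 hm0 hu x with rfl | rfl | rfl | rfl
    · exact ⟨0, map_zero g⟩
    · exact ⟨1, map_one g⟩
    · exact ⟨Ideal.Quotient.mk _ Polynomial.X, hX⟩
    · exact ⟨Ideal.Quotient.mk _ (1 + Polynomial.X), by
        change f (1 + Polynomial.X) = _; rw [map_add, map_one, hX]⟩
  have : Finite ((ZMod 2)[X] ⧸ Ideal.span {(Polynomial.X : (ZMod 2)[X]) ^ 2}) :=
    Nat.finite_of_card_ne_zero (by rw [card_zmod_two_polynomial_quotient]; decide)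
  exact ⟨(RingEquiv.ofBijective g (hg.bijective_of_nat_card_le
    (by rw [card_zmod_two_polynomial_quotient, h4]))).symm⟩

theorem nonempty_ringEquiv_of_isIdempotentElem (h4 : Nat.card A = 4) {m : A} (hm0 : m ≠ 0)
    (hu : ¬ IsUnit m) (hm : IsIdempotentElem m) : Nonempty (A ≃+* ZMod 2 × ZMod 2) := by
  have : Finite A := Nat.finite_of_card_ne_zero (by rw [h4]; decide)
  have hfin : ∀ I : Ideal A, Finite (A ⧸ I) := fun I =>
    Finite.of_surjective _ Ideal.Quotient.mk_surjective
  have e := ringEquivProdOfIsIdempotentElem hm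
  have hu' : ¬ IsUnit (1 - m) := fun h => hm0 <| by
    rw [← h.mul_left_eq_zero, mul_sub, mul_one, hm.eq, sub_self]
  have := nontrivial_quotient_span_singleton hu
  have := nontrivial_quotient_span_singleton hu'
  have h1 : 1 < Nat.card (A ⧸ Ideal.span {m}) := Finite.one_lt_card
  have h2 : 1 < Nat.card (A ⧸ Ideal.span {1 - m}) := Finite.one_lt_card
  have hmul := Nat.card_congr e.toEquiv
  rw [h4, Nat.card_prod] at hmul
  have hle : Nat.card (A ⧸ Ideal.span {m}) ≤ 2 := by nlinarith
  have hc1 : Nat.card (A ⧸ Ideal.span {m}) = 2 := by omega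
  rw [hc1] at hmul
  obtain ⟨e1⟩ := nonempty_ringEquiv_zmod_of_prime Nat.prime_two hc1
  obtain ⟨e2⟩ := nonempty_ringEquiv_zmod_of_prime (A := A ⧸ Ideal.span {1 - m}) Nat.prime_two
    (by omega)
  exact ⟨e.trans (RingEquiv.prodCongr e1 e2)⟩

/-- The classification of the rings of order four that are not fields. -/
theorem ringEquiv_cases_of_card_eq_four (h4 : Nat.card A = 4) {m : A} (hm0 : m ≠ 0)
    (hu : ¬ IsUnit m) :
    Nonempty (A ≃+* ZMod 4) ∨
    Nonempty (A ≃+* (ZMod 2)[X] ⧸ Ideal.span {(Polynomial.X : (ZMod 2)[X]) ^ 2}) ∨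
    Nonempty (A ≃+* ZMod 2 × ZMod 2) := by
  have : Finite A := Nat.finite_of_card_ne_zero (by rw [h4]; decide)
  have : Nontrivial A := ⟨m, 0, hm0⟩
  by_cases h2 : (2 : A) = 0
  · right
    -- The values `1` and `1 + m` of `m * m` would make `m` a unit, with inverse `m` or `m - 1`.
    rcases eq_of_card_eq_four h4 h2 hm0 hu (m * m) with h | h | h | h
    · exact .inl (nonempty_ringEquiv_of_sq_eq_zero h4 h2 hm0 h)
    · exact absurd (IsUnit.of_mul_eq_one m h) hu
    · exact .inr (nonempty_ringEquiv_of_isIdempotentElem h4 hm0 hu h)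
    · exact absurd (IsUnit.of_mul_eq_one (m - 1) (by linear_combination h)) hu
  · left
    have := Fintype.ofFinite A
    have hdvd : ringChar A ∣ 4 := by
      rw [← ringChar.spec, ← h4, Nat.card_eq_fintype_card, Nat.cast_card_eq_zero]
    have hn2 : ¬ ringChar A ∣ 2 := fun h => h2 (by exact_mod_cast (ringChar.spec A 2).2 h)
    have hchar : ringChar A = 4 := by
      have := Nat.le_of_dvd (by decide) hdvd
      interval_cases ringChar A <;> omega
    have : CharP A 4 := ringChar.of_eq hchar
    exact ⟨(ZMod.ringEquiv A (by rw [← Nat.card_eq_fintype_card, h4])).symm⟩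

theorem isField_or_exists_not_isUnit [Nontrivial A] :
    IsField A ∨ ∃ m : A, m ≠ 0 ∧ ¬ IsUnit m := by
  by_contra! h
  exact h.1 ⟨exists_pair_ne A, mul_comm, fun ha => (h.2 _ ha).exists_right_inv⟩

/-- The classification of the nontrivial rings with at most four elements. -/
theorem ringEquiv_cases_of_card_le_four [Nontrivial A] [Finite A] (h : Nat.card A ≤ 4) :
    Nonempty (A ≃+* ZMod 2) ∨ Nonempty (A ≃+* ZMod 3) ∨ Nonempty (A ≃+* GaloisField 2 2) ∨
    ((∃ m : A, m ≠ 0 ∧ ¬ IsUnit m) ∧ (Nonempty (A ≃+* ZMod 4) ∨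
      Nonempty (A ≃+* (ZMod 2)[X] ⧸ Ideal.span {(Polynomial.X : (ZMod 2)[X]) ^ 2}) ∨
      Nonempty (A ≃+* ZMod 2 × ZMod 2))) := by
  have h1 : 1 < Nat.card A := Finite.one_lt_card
  obtain h | h | h : Nat.card A = 2 ∨ Nat.card A = 3 ∨ Nat.card A = 4 := by omega
  · exact .inl (nonempty_ringEquiv_zmod_of_prime Nat.prime_two h)
  · exact .inr (.inl (nonempty_ringEquiv_zmod_of_prime Nat.prime_three h))
  · rcases isField_or_exists_not_isUnit (A := A) with hA | ⟨m, hm0, hm⟩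
    · exact .inr (.inr (.inl (nonempty_ringEquiv_galoisField_two_two hA h)))
    · exact .inr (.inr (.inr ⟨⟨m, hm0, hm⟩, ringEquiv_cases_of_card_eq_four h hm0 hm⟩))

theorem isPlanarGraph_upperIdealGraph_zmod_two_prod_polynomial_quotient :
    IsPlanarGraph (upperIdealGraph
      (ZMod 2 × ((ZMod 2)[X] ⧸ Ideal.span {(Polynomial.X : (ZMod 2)[X]) ^ 2}))) := by
  have h4 := card_zmod_two_polynomial_quotient
  have : Finite ((ZMod 2)[X] ⧸ Ideal.span {(Polynomial.X : (ZMod 2)[X]) ^ 2}) :=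
    Nat.finite_of_card_ne_zero (by rw [h4]; decide)
  set m := Ideal.Quotient.mk (Ideal.span {(Polynomial.X : (ZMod 2)[X]) ^ 2}) Polynomial.X with hm
  have hm0 : m ≠ 0 := by
    rw [hm, Ne, Ideal.Quotient.eq_zero_iff_mem, Ideal.mem_span_singleton, Polynomial.X_pow_dvd_iff]
    intro h
    simpa using h 1 (by decide)
  have hmm : m * m = 0 := by
    rw [hm, ← map_mul, ← pow_two, Ideal.Quotient.eq_zero_iff_mem]
    exact Ideal.mem_span_singleton_self _
  have hu : ¬ IsUnit m := fun h => hm0 (h.mul_left_eq_zero.1 hmm)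
  have h2 : (2 : (ZMod 2)[X] ⧸ Ideal.span {(Polynomial.X : (ZMod 2)[X]) ^ 2}) = 0 := by
    have : (2 : (ZMod 2)[X]) = 0 := CharTwo.two_eq_zero
    rw [← map_ofNat (Ideal.Quotient.mk _), this, map_zero]
  refine isPlanarGraph_upperIdealGraph_zmod_two_prod h4 hm0 (fun x hx => ?_)
  rcases eq_of_card_eq_four h4 h2 hm0 hu x with h | rfl | h | rfl
  · exact .inl h
  · exact absurd isUnit_one hx
  · exact .inr h
  -- Since `m * m = 0`, the inverse of `1 + m` is `1 - m`.
  · exact absurd (IsUnit.of_mul_eq_one (1 - m) (by linear_combination -hmm)) hx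

end Classification

/-! ### The classification theorem -/

theorem theorem4p3 (R : Type*) [CommRing R] [Finite R] [Nontrivial R] (hR : ¬ IsLocalRing R) :
    IsPlanarGraph (upperIdealGraph R) ↔
      Nonempty (R ≃+* ZMod 2 × ZMod 2 × ZMod 2) ∨
      Nonempty (R ≃+* ZMod 2 × ZMod 4) ∨
      Nonempty (R ≃+* ZMod 2 × ((ZMod 2)[X] ⧸ Ideal.span {(Polynomial.X : (ZMod 2)[X]) ^ 2})) ∨
      Nonempty (R ≃+* ZMod 2 × GaloisField 2 2) ∨
      Nonempty (R ≃+* ZMod 2 × ZMod 2) ∨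
      Nonempty (R ≃+* ZMod 2 × ZMod 3) ∨
      Nonempty (R ≃+* ZMod 3 × ZMod 3) ∨
      Nonempty (R ≃+* ZMod 3 × GaloisField 2 2) ∨
      Nonempty (R ≃+* GaloisField 2 2 × GaloisField 2 2) := by
  constructor
  · intro h
    have hfin : ∀ I : Ideal R, Finite (R ⧸ I) := fun I =>
      Finite.of_surjective _ Ideal.Quotient.mk_surjective
    obtain ⟨I, J, hI, hJ, ⟨e⟩⟩ := exists_ringEquiv_prod_of_not_isLocalRing hR
    have hp : IsPlanarGraph (upperIdealGraph ((R ⧸ I) × (R ⧸ J))) :=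
      h.upperIdealGraph_of_ringEquiv e.symm
    have hp' : IsPlanarGraph (upperIdealGraph ((R ⧸ J) × (R ⧸ I))) :=
      hp.upperIdealGraph_of_ringEquiv RingEquiv.prodComm
    -- A factor that is not a field forces the other to be `ZMod 2`. Stated for arbitrary ideals,
    -- this serves both orders of the factors.
    have key : ∀ I J : Ideal R, Nontrivial (R ⧸ J) → R ≃+* (R ⧸ I) × (R ⧸ J) →
        IsPlanarGraph (upperIdealGraph ((R ⧸ I) × (R ⧸ J))) →
        (∃ m : R ⧸ I, m ≠ 0 ∧ ¬ IsUnit m) →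
        (Nonempty (R ⧸ I ≃+* ZMod 4) ∨
          Nonempty (R ⧸ I ≃+* (ZMod 2)[X] ⧸ Ideal.span {(Polynomial.X : (ZMod 2)[X]) ^ 2}) ∨
          Nonempty (R ⧸ I ≃+* ZMod 2 × ZMod 2)) →
        Nonempty (R ≃+* ZMod 2 × ZMod 2 × ZMod 2) ∨
        Nonempty (R ≃+* ZMod 2 × ZMod 4) ∨
        Nonempty
          (R ≃+* ZMod 2 × ((ZMod 2)[X] ⧸ Ideal.span {(Polynomial.X : (ZMod 2)[X]) ^ 2})) := by
      rintro I J hJ e hp ⟨m, hm0, hm⟩ hI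
      have h1 : 1 < Nat.card (R ⧸ J) := Finite.one_lt_card
      have h2 := card_le_two_of_isPlanarGraph_prod hm0 hm hp
      obtain ⟨eJ⟩ := nonempty_ringEquiv_zmod_of_prime (A := R ⧸ J) Nat.prime_two (by omega)
      rcases hI with ⟨⟨eI⟩⟩ | ⟨⟨eI⟩⟩ | ⟨⟨eI⟩⟩
      · exact .inr (.inl ⟨(e.trans RingEquiv.prodComm).trans (RingEquiv.prodCongr eJ eI)⟩)
      · exact .inr (.inr ⟨(e.trans RingEquiv.prodComm).trans (RingEquiv.prodCongr eJ eI)⟩)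
      · exact .inl ⟨(e.trans RingEquiv.prodComm).trans (RingEquiv.prodCongr eJ eI)⟩
    have e' := e.trans RingEquiv.prodComm
    rcases ringEquiv_cases_of_card_le_four (card_le_four_of_isPlanarGraph_prod hp') with
      ⟨⟨eI⟩⟩ | ⟨⟨eI⟩⟩ | ⟨⟨eI⟩⟩ | ⟨hm, hI'⟩
    on_goal 4 => have := key I J hJ e hp hm hI'; tauto
    all_goals
      rcases ringEquiv_cases_of_card_le_four (card_le_four_of_isPlanarGraph_prod hp) with
        ⟨⟨eJ⟩⟩ | ⟨⟨eJ⟩⟩ | ⟨⟨eJ⟩⟩ | ⟨hm, hJ'⟩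
      on_goal 4 => have := key J I hI e' hp' hm hJ'; tauto
      -- Both factors are now among `ZMod 2`, `ZMod 3` and the field of order four; recording both
      -- orders covers the nine ordered pairs by the six listed products.
      all_goals
        have h1 := Nonempty.intro (e.trans (RingEquiv.prodCongr eI eJ))
        have h2 := Nonempty.intro (e'.trans (RingEquiv.prodCongr eJ eI))
        tauto
  · have hF : Nat.card (GaloisField 2 2) ≤ 4 := (GaloisField.card 2 2 two_ne_zero).le
    have h2 : Nat.card (ZMod 2) ≤ 4 := by simp
    have h3 : Nat.card (ZMod 3) ≤ 4 := by simp
    have : Fact (Nat.Prime 3) := ⟨Nat.prime_three⟩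
    rintro (⟨⟨e⟩⟩ | ⟨⟨e⟩⟩ | ⟨⟨e⟩⟩ | ⟨⟨e⟩⟩ | ⟨⟨e⟩⟩ | ⟨⟨e⟩⟩ | ⟨⟨e⟩⟩ | ⟨⟨e⟩⟩ | ⟨⟨e⟩⟩) <;>
      refine IsPlanarGraph.upperIdealGraph_of_ringEquiv e ?_
    · exact isPlanarGraph_upperIdealGraph_zmod_two_cubed
    · exact isPlanarGraph_upperIdealGraph_zmod_two_prod (m := 2) (by simp) (by decide) (by decide)
    · exact isPlanarGraph_upperIdealGraph_zmod_two_prod_polynomial_quotient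
    · exact isPlanarGraph_upperIdealGraph_prod_field h2 hF
    · exact isPlanarGraph_upperIdealGraph_prod_field h2 h2
    · exact isPlanarGraph_upperIdealGraph_prod_field h2 h3
    · exact isPlanarGraph_upperIdealGraph_prod_field h3 h3
    · exact isPlanarGraph_upperIdealGraph_prod_field h3 hF
    · exact isPlanarGraph_upperIdealGraph_prod_field hF hF
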